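/- Let $\mathcal{A}$ be a Grothendieck category with a generator $U$, let $R=\mathrm{End}_{\mathcal{A}}(U)$, and let $S=\mathrm{Hom}_{\mathcal{A}}(U,-):\mathcal{A}\to \mathrm{Mod}(R)$ be the induced functor to the category of right $R$-modules, where $R$ acts on $\mathrm{Hom}_{\mathcal{A}}(U,X)$ by composition on the right. In an abelian category, a monomorphism $e:K\to L$ is called essential if every morphism $h:L\to P$ such that $he$ is a monomorphism is itself a monomorphism; a morphism $s:L\to M$ is called a section if there is $r:M\to L$ with $rs=1_L$. For objects $M$ and $N$ of an abelian category, $N$ is called $M$-CS-Rickart if for every morphism $f:M\to N$ there are an essential monomorphism $e:\mathrm{Ker}(f)\to L$ and a section $s:L\to M$ such that $\ker(f)=se$, where $\ker(f):\mathrm{Ker}(f)\to M$ is the kernel of $f$. Let $M$ and $N$ be objects of $\mathcal{A}$. Then $N$ is $M$-CS-Rickart in $\mathcal{A}$ if and only if $S(N)$ is $S(M)$-CS-Rickart in $\mathrm{Mod}(R)$. -/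

import Mathlib

open CategoryTheory CategoryTheory.Limits

universe v u

/-- A monomorphism `f : A ⟶ B` is essential if every morphism `h` out of `B` whose composite
with `f` is a monomorphism is itself a monomorphism. -/
def IsEssentialMono {C : Type u} [Category.{v} C] {A B : C} (f : A ⟶ B) : Prop :=
  Mono f ∧ ∀ ⦃P : C⦄ (h : B ⟶ P), Mono (f ≫ h) → Mono h

/-- `IsCSRickart M N`: the object `N` is `M`-CS-Rickart. That is, for every morphism `f : M ⟶ N`,
the kernel `Ker f ⟶ M` factors as an essential monomorphism `e : Ker f ⟶ L` followed by
a section (split monomorphism) `s : L ⟶ M`. -/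
def IsCSRickart {C : Type u} [Category.{v} C] [Abelian C] (M N : C) : Prop :=
  ∀ f : M ⟶ N, ∃ (L : C) (e : kernel f ⟶ L) (s : L ⟶ M),
    IsEssentialMono e ∧ IsSplitMono s ∧ kernel.ι f = e ≫ s

/-!
By the Gabriel–Popescu theorem, `S = Hom(U, -)` is fully faithful and has an exact left adjoint
`T`, and the theorem holds for every such functor between abelian categories, because both halves
of the CS-Rickart condition pass through `S`.

* Essential monomorphisms: `S` reflects them since it preserves and reflects monomorphisms
  (`IsEssentialMono.of_map`). It preserves them (`IsEssentialMono.map`) because a map `h` out of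
  `S L` for which `S e ≫ h` is a monomorphism gives, after applying the exact functor `T` and
  `T S ≅ 1`, a monomorphism `T h`; then `h` is a monomorphism by naturality of the unit, which is
  invertible at `S L`.
* Sections: a direct summand of `S M` is cut out by an idempotent of `S M`. By full faithfulness
  this idempotent comes from one of `M`, which splits, so the summand lies in the essential image
  of `S`.

As a right adjoint, `S` also preserves kernels, so the factorizations of the two kernels correspond
(`isCSRickart_map_iff`).
-/

namespace IsEssentialMono

variable {C : Type*} [Category* C]

lemma iso_comp {A B B' : C} {f : B ⟶ B'} (hf : IsEssentialMono f) (i : A ⟶ B) [IsIso i] :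
    IsEssentialMono (i ≫ f) := by
  have := hf.1
  refine ⟨inferInstance, fun P h _ => hf.2 h ?_⟩
  have : f ≫ h = inv i ≫ (i ≫ f) ≫ h := by simp
  rw [this]
  infer_instance

lemma comp_iso {A B B' : C} {f : A ⟶ B} (hf : IsEssentialMono f) (i : B ⟶ B') [IsIso i] :
    IsEssentialMono (f ≫ i) := by
  have := hf.1
  refine ⟨inferInstance, fun P h _ => ?_⟩
  have : Mono (i ≫ h) := hf.2 _ (by rw [← Category.assoc]; infer_instance)
  have : h = inv i ≫ i ≫ h := by simp
  rw [this]
  infer_instance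

variable {D : Type*} [Category* D]

lemma of_map (F : C ⥤ D) [F.PreservesMonomorphisms] [F.ReflectsMonomorphisms] {K L : C}
    {e : K ⟶ L} (he : IsEssentialMono (F.map e)) : IsEssentialMono e := by
  refine ⟨F.mono_of_mono_map he.1, fun P h _ => F.mono_of_mono_map (he.2 _ ?_)⟩
  rw [← F.map_comp]
  infer_instance

/-- A fully faithful functor preserves essential monomorphisms if it has a left adjoint that
preserves monomorphisms. -/
lemma map {F : C ⥤ D} [F.Full] [F.Faithful] {T : D ⥤ C} (adj : T ⊣ F)
    [T.PreservesMonomorphisms] {K L : C} {e : K ⟶ L} (he : IsEssentialMono e) :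
    IsEssentialMono (F.map e) := by
  have := he.1
  have : F.PreservesMonomorphisms := F.preservesMonomorphisms_of_adjunction adj
  refine ⟨inferInstance, fun P h _ => ?_⟩
  have : Mono (inv (adj.counit.app L) ≫ T.map h) := by
    refine he.2 _ ?_
    have : e ≫ inv (adj.counit.app L) ≫ T.map h =
        inv (adj.counit.app K) ≫ T.map (F.map e ≫ h) := by
      rw [IsIso.eq_inv_comp, T.map_comp, ← adj.counit_naturality_assoc]
      simp
    rw [this]
    infer_instance
  have : T.map h = adj.counit.app L ≫ inv (adj.counit.app L) ≫ T.map h := by simp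
  have : Mono (T.map h) := by
    rw [this]
    infer_instance
  have : Mono (h ≫ adj.unit.app P) := by
    rw [← adj.unit_naturality]
    infer_instance
  exact mono_of_mono h (adj.unit.app P)

end IsEssentialMono

/-- The CS-Rickart condition is invariant under fully faithful functors between abelian categories
that have an exact left adjoint. -/
theorem isCSRickart_map_iff {C D : Type*} [Category* C] [Abelian C] [Category* D] [Abelian D]
    {F : C ⥤ D} [F.Full] [F.Faithful] [F.PreservesZeroMorphisms] {T : D ⥤ C} (adj : T ⊣ F)
    [T.PreservesMonomorphisms] (M N : C) :
    IsCSRickart M N ↔ IsCSRickart (F.obj M) (F.obj N) := by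
  have := adj.rightAdjoint_preservesLimits
  constructor
  · intro H g
    obtain ⟨f, rfl⟩ := F.map_surjective g
    obtain ⟨L, e, s, he, hs, h⟩ := H f
    refine ⟨F.obj L, (PreservesKernel.iso F f).inv ≫ F.map e, F.map s,
      (he.map adj).iso_comp _, inferInstance, ?_⟩
    rw [Category.assoc, ← F.map_comp, ← h, PreservesKernel.iso_inv_ι]
  · intro H f
    obtain ⟨L', e', s', he', ⟨⟨r', hr'⟩⟩, h⟩ := H (F.map f)
    obtain ⟨p, hp⟩ := F.map_surjective (r' ≫ s')
    -- Split the idempotent `p` of `M` that corresponds to the summand `L'` of `F.obj M`.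
    obtain ⟨L, i, r, hir, hri⟩ := IsIdempotentComplete.idempotents_split M p
      (F.map_injective (by simp [hp, reassoc_of% hr']))
    have hFir : F.map i ≫ F.map r = 𝟙 _ := by rw [← F.map_comp, hir, F.map_id]
    have hFri : F.map r ≫ F.map i = r' ≫ s' := by rw [← F.map_comp, hri, hp]
    have : IsIso (s' ≫ F.map r) := by
      refine ⟨F.map i ≫ r', ?_, ?_⟩
      · rw [Category.assoc, reassoc_of% hFri, hr', Category.comp_id, hr']
      · rw [Category.assoc, ← reassoc_of% hFri, hFir, Category.comp_id, hFir]
    have hk : F.map (kernel.ι f) = (PreservesKernel.iso F f).hom ≫ e' ≫ s' := by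
      rw [← h, PreservesKernel.iso_hom, kernelComparison_comp_ι]
    have hess : IsEssentialMono (F.map (kernel.ι f ≫ r)) := by
      have : F.map (kernel.ι f ≫ r) =
          (PreservesKernel.iso F f).hom ≫ e' ≫ s' ≫ F.map r := by
        simp [hk]
      rw [this]
      exact (he'.comp_iso _).iso_comp _
    refine ⟨L, kernel.ι f ≫ r, i, hess.of_map, ⟨⟨r, hir⟩⟩, F.map_injective ?_⟩
    rw [F.map_comp, F.map_comp, Category.assoc, hFri, hk]
    simp [reassoc_of% hr']

/-- Multiplication in `End U` is composition of maps (`f * g = f ∘ g`), so right `End U`-modules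
are modules over `(End U)ᵐᵒᵖ`; `preadditiveCoyonedaObj U` is the functor `Hom(U, -)` into them,
with `r ∈ End U` acting on `x : U ⟶ X` on the right by `x ∘ r`. -/
theorem mainTheorem7 {A : Type u} [Category.{v} A] [Abelian A]
    [IsGrothendieckAbelian.{v} A] (U : A) (hU : IsSeparator U) (M N : A) :
    IsCSRickart M N ↔
      IsCSRickart ((preadditiveCoyonedaObj U).obj M : ModuleCat.{v} (End U)ᵐᵒᵖ)
        ((preadditiveCoyonedaObj U).obj N) := by
  have := IsGrothendieckAbelian.GabrielPopescu.full U hU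
  have := (isSeparator_iff_faithful_preadditiveCoyonedaObj U).1 hU
  have := IsGrothendieckAbelian.GabrielPopescu.preservesFiniteLimits U hU
  exact isCSRickart_map_iff
    (IsGrothendieckAbelian.tensorObjPreadditiveCoyonedaObjAdjunction U) M N
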